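/- For $n\ge 1$ and $c\in\{0,1\}^n$ let $$f_c(x)=\max_{1\le i\le n}|\pi(x_i)-c_i|+\sum_{i=1}^n|\pi(x_i)-x_i|\qquad(x\in\mathbb{R}^n),$$ where $\pi(t)=\min\{1,\max\{0,t\}\}$ is the projection $\mathbb{R}\to[0,1]$; thus $f_c(x)=\max_i|x_i-c_i|$ on $[0,1]^n$. In the max-norm optimization problem $c$ is unknown, and $f_c$ is accessed through the (exact) quantum evaluation oracle, i.e. the unitary $$O_{f_c}\colon |x,y,w\rangle\mapsto|x,\,y+f_c(x),\,w\rangle ,\qquad\text{in particular } O_{f_c}|x,0,w\rangle=|x,f_c(x),w\rangle,$$ on $\ell^2(D\times\mathbb{R}\times W)$, where $D\subseteq\mathbb{R}^n$ is the set of admissible query points and $W$ labels an arbitrary workspace. A quantum algorithm with $T$ queries starts in a fixed basis state, applies $U_TO_{f_c}U_{T-1}\cdots U_1O_{f_c}U_0$ with unitaries $U_k$ independent of $c$, measures in the basis, and outputs a point $\tilde x\in\mathbb{R}^n$ that is a function of the measurement outcome. It solves the problem if, for every $c\in\{0,1\}^n$, with probability at least $0.9$ it outputs $\tilde x\in[0,1]^n$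 with $$f_c(\tilde x)\le\min_{x\in[0,1]^n}f_c(x)+\tfrac13 .$$ The quantum query complexity of the problem is the least number of queries of a quantum algorithm that solves it. **Theorem.** There are absolute constants $a,C>0$ such that for every $n\ge 2$ and every $D\subseteq\mathbb{R}^n$ with $\{0,\tfrac12,1\}^n\subseteq D$ (in particular for $D=[0,1]^n$ and for $D=\mathbb{R}^n$) the following hold. 1. There is a quantum algorithm with at most $C\sqrt n\,\log n$ evaluation queries, at points of $D$, that for every $c\in\{0,1\}^n$ outputs exactly $\tilde x=c$, the minimizer of $f_c$, with probability at least $0.9$. 2. The quantum query complexity $Q$ of the max-norm optimization problem with queries in $D$ satisfies $$a\,\frac{\sqrt n}{\log n}\;\le\;Q\;\le\;C\sqrt n\,\log n ,$$ that is, $Q=\tilde\Theta(\sqrt n)$. -/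

import Mathlib

noncomputable section

namespace MaxNorm

/-- The projection `π : ℝ → [0,1]`. -/
def proj (t : ℝ) : ℝ := if t < 0 then 0 else if t ≤ 1 then t else 1

/-- The bit string `c ∈ {0,1}ⁿ`, regarded as a point of `ℝⁿ`. -/
def corner {n : ℕ} (c : Fin n → Bool) : Fin n → ℝ := fun i => if c i then 1 else 0

/-- The max-norm objective function
`f_c(x) = max_i |π(x_i) - c_i| + ∑_i |π(x_i) - x_i|` on `ℝⁿ`
(used for `n ≥ 1`, where the supremum is a maximum over a finite nonempty set). -/
def objective {n : ℕ} (c : Fin n → Bool) (x : Fin n → ℝ) : ℝ :=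
  (⨆ i, |proj (x i) - corner c i|) + ∑ i, |proj (x i) - x i|

/-- The unit cube `[0,1]ⁿ`. -/
def cube (n : ℕ) : Set (Fin n → ℝ) := {x | ∀ i, 0 ≤ x i ∧ x i ≤ 1}

/-- The points of `[0,1]ⁿ` all of whose coordinates lie in `{0, 1/2, 1}`. -/
def grid (n : ℕ) : Set (Fin n → ℝ) := {x | ∀ i, x i = 0 ∨ x i = 1 / 2 ∨ x i = 1}

/-- The points `x ∈ [0,1]ⁿ` with `f_c(x) ≤ min_{z ∈ [0,1]ⁿ} f_c(z) + ε`. -/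
def approxMinimizers {n : ℕ} (c : Fin n → Bool) (ε : ℝ) : Set (Fin n → ℝ) :=
  {x | x ∈ cube n ∧ ∀ z ∈ cube n, objective c x ≤ objective c z + ε}

end MaxNorm

namespace QuantumQuery

/-- The Hilbert space `ℓ²(ι)` with orthonormal basis `|b⟩`, `b ∈ ι`. -/
abbrev HSpace (ι : Type) : Type := lp (fun _ : ι => ℂ) 2

open Classical in
/-- The basis vector `|b⟩`. -/
def ket {ι : Type} (b : ι) : HSpace ι := lp.single 2 b (1 : ℂ)

/-- A permutation of the basis labels keeps square-summability. -/
theorem memlp_permute {ι : Type} (e : ι ≃ ι) (ψ : HSpace ι) :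
    Memℓp (fun b => ψ (e.symm b)) 2 := by
  have h := lp.memℓp ψ
  rw [memℓp_gen_iff (by norm_num)] at h ⊢
  exact (e.symm.summable_iff (f := fun b => ‖ψ b‖ ^ (2 : ENNReal).toReal)).2 h

/-- The unitary of `ℓ²(ι)` that permutes the basis: `|b⟩ ↦ |e b⟩`. -/
def permute {ι : Type} (e : ι ≃ ι) : HSpace ι ≃ₗᵢ[ℂ] HSpace ι where
  toFun ψ := ⟨fun b => ψ (e.symm b), memlp_permute e ψ⟩
  invFun ψ := ⟨fun b => ψ (e b), memlp_permute e.symm ψ⟩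
  left_inv ψ := by ext b; simp
  right_inv ψ := by ext b; simp
  map_add' ψ φ := by ext b; rfl
  map_smul' a ψ := by ext b; rfl
  norm_map' ψ := by
    have h2 : 0 < (2 : ENNReal).toReal := by norm_num
    rw [lp.norm_eq_tsum_rpow h2, lp.norm_eq_tsum_rpow h2]
    congr 1
    exact e.symm.tsum_eq (fun b => ‖ψ b‖ ^ (2 : ENNReal).toReal)

theorem permute_ket {ι : Type} (e : ι ≃ ι) (b : ι) : permute e (ket b) = ket (e b) := by
  classical
  ext a
  change (ket b : HSpace ι) (e.symm a) = (ket (e b) : HSpace ι) a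
  simp only [ket, lp.single_apply, Pi.single_apply, Equiv.symm_apply_eq]

/-- Basis labels `(x, y, w)`: query register `x ∈ X`, answer register `y ∈ ℝ`,
workspace register `w ∈ W`. -/
abbrev Label (X W : Type) : Type := X × ℝ × W

/-- The permutation `(x, y, w) ↦ (x, y + f x, w)` of the basis labels. -/
def oraclePerm {X W : Type} (f : X → ℝ) : Label X W ≃ Label X W where
  toFun b := (b.1, b.2.1 + f b.1, b.2.2)
  invFun b := (b.1, b.2.1 - f b.1, b.2.2)
  left_inv b := by simp
  right_inv b := by simp

/-- The evaluation oracle `O_f`, with precise answers: the unitary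
`O_f |x, y, w⟩ = |x, y + f x, w⟩`; in particular `O_f |x, 0, w⟩ = |x, f x, w⟩`. -/
def oracle {X W : Type} (f : X → ℝ) : HSpace (Label X W) ≃ₗᵢ[ℂ] HSpace (Label X W) :=
  permute (oraclePerm f)

theorem oracle_ket {X W : Type} (f : X → ℝ) (x : X) (y : ℝ) (w : W) :
    oracle f (ket (x, y, w)) = ket (x, y + f x, w) :=
  permute_ket _ _

/-- A quantum algorithm that queries an unknown function `f : X → ℝ` and outputs an element of
`Y`. It starts in a basis state, alternates unitaries `U 0, …, U queries` that do not depend on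
`f` with `queries` uses of the oracle, measures in the basis, and applies the classical map
`output` to the outcome. (The values `U k` for `k > queries` are not used.) -/
structure Algorithm (X Y : Type) where
  /-- labels of the workspace register -/
  W : Type
  /-- the number of oracle queries -/
  queries : ℕ
  /-- label of the initial basis state -/
  init : Label X W
  /-- the unitaries between the queries -/
  U : ℕ → (HSpace (Label X W) ≃ₗᵢ[ℂ] HSpace (Label X W))
  /-- classical processing of the measurement outcome -/
  output : Label X W → Y

namespace Algorithm

variable {X Y : Type}

/-- The state after `k` queries to `f` (and the unitary that follows the last of them). -/
def state (A : Algorithm X Y) (f : X → ℝ) : ℕ → HSpace (Label X A.W)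
  | 0 => A.U 0 (ket A.init)
  | k + 1 => A.U (k + 1) (oracle f (A.state f k))

/-- The state `U_T O_f U_{T-1} ⋯ U_1 O_f U_0 |init⟩` that is measured, `T = queries`. -/
def finalState (A : Algorithm X Y) (f : X → ℝ) : HSpace (Label X A.W) :=
  A.state f A.queries

/-- The probability that the output lies in `G`, when the oracle is `O_f`. -/
def prob (A : Algorithm X Y) (f : X → ℝ) (G : Set Y) : ℝ :=
  ∑' b : {b : Label X A.W // A.output b ∈ G}, ‖A.finalState f b.1‖ ^ 2

end Algorithm

end QuantumQuery

namespace MaxNorm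

/-- The answers of the evaluation oracle for `f_c`, with queries at the points of `D`. -/
def evalOn {n : ℕ} (D : Set (Fin n → ℝ)) (c : Fin n → Bool) : D → ℝ :=
  fun x => objective c x.1

/-- Algorithms for max-norm optimization, with evaluation queries at the points of `D`. -/
abbrev Solver {n : ℕ} (D : Set (Fin n → ℝ)) : Type 1 :=
  QuantumQuery.Algorithm D (Fin n → ℝ)

/-- For every `c`, the algorithm outputs the point `c` with probability at least `0.9`. -/
def SolvesExactly {n : ℕ} {D : Set (Fin n → ℝ)} (A : Solver D) : Prop :=
  ∀ c : Fin n → Bool, (9 / 10 : ℝ) ≤ A.prob (evalOn D c) {corner c}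

/-- For every `c`, the algorithm outputs, with probability at least `0.9`, a point
`x ∈ [0,1]ⁿ` such that `f_c(x) ≤ min_{z ∈ [0,1]ⁿ} f_c(z) + 1/3`. -/
def Solves {n : ℕ} {D : Set (Fin n → ℝ)} (A : Solver D) : Prop :=
  ∀ c : Fin n → Bool, (9 / 10 : ℝ) ≤ A.prob (evalOn D c) (approxMinimizers c (1 / 3))

/-- `Q` is the quantum query complexity of max-norm optimization with queries in `D`: the
least number of queries of a quantum algorithm that solves the problem. -/
def IsQueryComplexity {n : ℕ} (D : Set (Fin n → ℝ)) (Q : ℕ) : Prop :=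
  IsLeast {T : ℕ | ∃ A : Solver D, Solves A ∧ A.queries = T} Q

end MaxNorm

end

/-! Both bounds hold without the logarithms: the complexity is of order `√n`, and `log n ≥ 0.69` for
`n ≥ 2` gives the stated form.

Lower bound: an adversary argument on the edges `(c, flip c i)` of the hypercube. Each input has `n`
neighbours; the inner products of the two states along the edges start at 1 and must fall to
`13/20`. A query changes them only through query points where the two objectives differ, and at a
given point only one neighbour of `c` can have a smaller value (`eq_of_objective_flip_lt`): the
flipped bit must be where the maximum for `c` is attained. Splitting the points by the sign of the
difference, and reindexing by `c ↦ flip c i`, caps the average loss per input at `4√n` per query,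
against a required `7n/20`.

Upper bound: a query in `{0, 1/2, 1}ⁿ` given by a set `S` and bits `y` reveals whether `c` agrees
with `y` on `S`. A dual adversary solution for this problem is supported on the pairs with at most
one disagreement. It gives `S` the weight `1/(|S|·C(n,|S|))`. Put the elements of `{1,…,n}` in
random order: this is the probability that `i` is preceded exactly by `S \ {i}`, for `i ∈ S`. Summed
over the `S` that meet `Δ` only in `i`, it is the probability `1/|Δ|` that `i` comes first in `Δ`;
hence feasibility. The objective value is at most `∑ₛ √s/s ≤ 2√n`.

Such a solution becomes an algorithm by way of ideal states that carry a scaled catalyst. The Gram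
matrix after a query equals that of the next ideal states (`inner_idealState_succ`), so an
input-independent unitary moves one family to the other. Leaving out the initial catalyst causes a
small error that never grows. -/

/-! ### Unitaries from equal Gram matrices -/

section Gram

variable {ι H : Type*} [Fintype ι] [NormedAddCommGroup H] [InnerProductSpace ℂ H]

theorem norm_linearCombination_eq_of_inner_eq {a b : ι → H}
    (h : ∀ i j, inner ℂ (a i) (a j) = inner ℂ (b i) (b j)) (x : ι → ℂ) :
    ‖Fintype.linearCombination ℂ a x‖ = ‖Fintype.linearCombination ℂ b x‖ := by
  rw [← sq_eq_sq₀ (norm_nonneg _) (norm_nonneg _)]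
  have key : ∀ a : ι → H, ‖Fintype.linearCombination ℂ a x‖ ^ 2 =
      RCLike.re (∑ j, x j * ∑ i, (starRingEnd ℂ) (x i) * inner ℂ (a i) (a j)) := by
    intro a
    rw [← inner_self_eq_norm_sq (𝕜 := ℂ)]
    simp only [Fintype.linearCombination_apply, sum_inner, inner_sum, inner_smul_left,
      inner_smul_right]
  rw [key, key]
  simp only [h]

/-- Equal norms of all linear combinations make `a i ↦ b i` a well-defined isometry on the span of
`a`; in finite dimension it extends to a unitary. -/
theorem exists_linearIsometryEquiv_of_inner_eq_of_finiteDimensional [FiniteDimensional ℂ H]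
    {a b : ι → H} (h : ∀ i j, inner ℂ (a i) (a j) = inner ℂ (b i) (b j)) :
    ∃ U : H ≃ₗᵢ[ℂ] H, ∀ i, U (a i) = b i := by
  classical
  set A := Fintype.linearCombination ℂ a
  set B := Fintype.linearCombination ℂ b
  have hn : ∀ x, ‖A x‖ = ‖B x‖ := norm_linearCombination_eq_of_inner_eq h
  -- The choice of the section `g` is harmless: by `hn`, `A` and `B` have the same kernel.
  obtain ⟨g, hg⟩ := A.rangeRestrict.exists_rightInverse_of_surjective
    (LinearMap.range_rangeRestrict A)
  have hg' : ∀ y, A (g y) = y := fun y => congrArg Subtype.val (LinearMap.congr_fun hg y)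
  let T : LinearMap.range A →ₗᵢ[ℂ] H :=
    { toLinearMap := B ∘ₗ g
      norm_map' := fun y => by
        change ‖B (g y)‖ = ‖(y : H)‖
        rw [← hn, hg'] }
  refine ⟨T.extend.toLinearIsometryEquiv rfl, fun i => ?_⟩
  have hA : A (Pi.single i 1) = a i := by simp [A, Fintype.linearCombination_apply_single]
  have hB : B (Pi.single i 1) = b i := by simp [B, Fintype.linearCombination_apply_single]
  have hmem : a i ∈ LinearMap.range A := ⟨_, hA⟩
  have h1 : T.extend (a i) = T ⟨a i, hmem⟩ := T.extend_apply ⟨a i, hmem⟩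
  change T.extend (a i) = b i
  rw [h1, ← hB]
  change B (g _) = _
  rw [← sub_eq_zero, ← map_sub, ← norm_eq_zero, ← hn, map_sub, hg', hA]
  simp

/-- Two finite families with the same Gram matrix are exchanged by a unitary. -/
theorem exists_linearIsometryEquiv_of_inner_eq
    {a b : ι → H} (h : ∀ i j, inner ℂ (a i) (a j) = inner ℂ (b i) (b j)) :
    ∃ U : H ≃ₗᵢ[ℂ] H, ∀ i, U (a i) = b i := by
  let K : Submodule ℂ H := Submodule.span ℂ (Set.range a ∪ Set.range b)
  have hfin : FiniteDimensional ℂ K :=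
    FiniteDimensional.span_of_finite ℂ ((Set.finite_range a).union (Set.finite_range b))
  have ha : ∀ i, a i ∈ K := fun i => Submodule.subset_span (Or.inl ⟨i, rfl⟩)
  have hb : ∀ i, b i ∈ K := fun i => Submodule.subset_span (Or.inr ⟨i, rfl⟩)
  obtain ⟨V, hV⟩ := exists_linearIsometryEquiv_of_inner_eq_of_finiteDimensional
    (H := K) (a := fun i => ⟨a i, ha i⟩) (b := fun i => ⟨b i, hb i⟩) h
  let e := K.orthogonalDecomposition
  -- `K` contains both families and is finite-dimensional; act by `V` on `K` and by the identity on
  -- its complement.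
  let M : WithLp 2 (K × Kᗮ) ≃ₗᵢ[ℂ] WithLp 2 (K × Kᗮ) :=
    { toLinearEquiv := (WithLp.linearEquiv 2 ℂ (K × Kᗮ)).trans
        ((V.toLinearEquiv.prodCongr (LinearEquiv.refl ℂ Kᗮ)).trans
          (WithLp.linearEquiv 2 ℂ (K × Kᗮ)).symm)
      norm_map' := fun x => by
        rw [← sq_eq_sq₀ (norm_nonneg _) (norm_nonneg _), WithLp.prod_norm_sq_eq_of_L2,
          WithLp.prod_norm_sq_eq_of_L2]
        congr 2
        exact V.norm_map x.fst }
  have he : ∀ x : K, e (x : H) = WithLp.toLp 2 (x, 0) := fun x => by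
    simp [e, Submodule.orthogonalDecomposition_apply]
  refine ⟨e.trans (M.trans e.symm), fun i => ?_⟩
  change e.symm (M (e (a i))) = b i
  rw [LinearIsometryEquiv.symm_apply_eq, he ⟨a i, ha i⟩, he ⟨b i, hb i⟩, ← hV]
  change WithLp.toLp 2 (V _, (0 : Kᗮ)) = _
  rfl

end Gram

/-! ### Basis vectors, coordinate projections and measurement probabilities -/

namespace QuantumQuery

open Classical in
theorem inner_ket {ι : Type} (a b : ι) :
    inner ℂ (ket a) (ket b) = if a = b then (1 : ℂ) else 0 := by
  rw [ket, lp.inner_single_left]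
  simp only [ket, lp.single_apply, Pi.single_apply]
  split_ifs <;> simp

theorem norm_ket {ι : Type} (a : ι) : ‖ket a‖ = 1 := by
  have h : ‖ket a‖ ^ 2 = 1 := by
    rw [← inner_self_eq_norm_sq (𝕜 := ℂ), inner_ket]; simp
  exact (pow_eq_one_iff_of_nonneg (norm_nonneg _) two_ne_zero).1 h

theorem inner_ket_left {ι : Type} (a : ι) (φ : HSpace ι) : inner ℂ (ket a) φ = φ a := by
  classical
  rw [ket, lp.inner_single_left]; simp

theorem summable_norm_sq {ι : Type} (φ : HSpace ι) : Summable fun b => ‖φ b‖ ^ 2 := by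
  have h := lp.memℓp φ
  rw [memℓp_gen_iff (by norm_num)] at h
  simpa using h

theorem norm_sq_eq_tsum {ι : Type} (φ : HSpace ι) : ‖φ‖ ^ 2 = ∑' b, ‖φ b‖ ^ 2 := by
  have h := lp.norm_rpow_eq_tsum (p := 2) (by norm_num) φ
  simpa using h

theorem norm_apply_le {ι : Type} (φ : HSpace ι) (b : ι) : ‖φ b‖ ≤ ‖φ‖ :=
  lp.norm_apply_le_norm (by norm_num) φ b

theorem memlp_indicator {ι : Type} (B : Set ι) (φ : HSpace ι) :
    Memℓp (B.indicator φ : ι → ℂ) 2 := by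
  rw [memℓp_gen_iff (by norm_num)]
  refine ((lp.memℓp φ).summable (by norm_num)).of_nonneg_of_le
    (fun b => by positivity) fun b => ?_
  exact Real.rpow_le_rpow (norm_nonneg _) (norm_indicator_le_norm_self _ _) (by norm_num)

/-- The projection onto the span of the basis vectors with labels in `B`. -/
noncomputable def restrict {ι : Type} (B : Set ι) (φ : HSpace ι) : HSpace ι :=
  ⟨B.indicator φ, memlp_indicator B φ⟩

theorem restrict_apply {ι : Type} (B : Set ι) (φ : HSpace ι) (b : ι) :
    restrict B φ b = B.indicator φ b := rfl

theorem restrict_add_restrict_compl {ι : Type} (B : Set ι) (φ : HSpace ι) :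
    restrict B φ + restrict Bᶜ φ = φ := by
  ext b
  exact Set.indicator_self_add_compl_apply B φ b

theorem inner_restrict_left {ι : Type} (B : Set ι) (φ ψ : HSpace ι) :
    inner ℂ (restrict B φ) ψ = inner ℂ (restrict B φ) (restrict B ψ) := by
  rw [lp.inner_eq_tsum, lp.inner_eq_tsum]
  congr 1; ext b
  by_cases hb : b ∈ B <;> simp [restrict_apply, hb]

theorem inner_restrict_right {ι : Type} (B : Set ι) (φ ψ : HSpace ι) :
    inner ℂ φ (restrict B ψ) = inner ℂ (restrict B φ) (restrict B ψ) := by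
  rw [← inner_conj_symm, inner_restrict_left, inner_conj_symm]

theorem norm_restrict_sq {ι : Type} (B : Set ι) (φ : HSpace ι) :
    ‖restrict B φ‖ ^ 2 = ∑' b, B.indicator (fun b => ‖φ b‖ ^ 2) b := by
  rw [norm_sq_eq_tsum]
  congr 1; ext b
  by_cases hb : b ∈ B <;> simp [restrict_apply, hb]

theorem norm_restrict_sq_add_compl {ι : Type} (B : Set ι) (φ : HSpace ι) :
    ‖restrict B φ‖ ^ 2 + ‖restrict Bᶜ φ‖ ^ 2 = ‖φ‖ ^ 2 := by
  rw [norm_restrict_sq, norm_restrict_sq, norm_sq_eq_tsum, ← Summable.tsum_add]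
  · congr 1; ext b; exact Set.indicator_self_add_compl_apply B _ b
  · exact (summable_norm_sq φ).indicator B
  · exact (summable_norm_sq φ).indicator Bᶜ

theorem norm_restrict_le {ι : Type} (B : Set ι) (φ : HSpace ι) : ‖restrict B φ‖ ≤ ‖φ‖ :=
  abs_le_of_sq_le_sq' (by nlinarith [norm_restrict_sq_add_compl B φ, sq_nonneg ‖restrict Bᶜ φ‖])
    (norm_nonneg _) |>.2

/-- Disjoint sets of labels carry total squared norm at most that of the vector. -/
theorem sum_norm_restrict_sq_le {ι κ : Type} [Fintype κ] (B : κ → Set ι)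
    (hB : ∀ i j, ∀ b, b ∈ B i → b ∈ B j → i = j) (φ : HSpace ι) :
    ∑ i, ‖restrict (B i) φ‖ ^ 2 ≤ ‖φ‖ ^ 2 := by
  classical
  simp only [norm_restrict_sq]
  rw [← Summable.tsum_finsetSum fun i _ => (summable_norm_sq φ).indicator (B i), norm_sq_eq_tsum]
  refine Summable.tsum_le_tsum (fun b => ?_)
    (summable_sum fun i _ => (summable_norm_sq φ).indicator (B i)) (summable_norm_sq φ)
  by_cases h : ∃ i, b ∈ B i
  · obtain ⟨i, hi⟩ := h
    rw [Finset.sum_eq_single i]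
    · simp [hi]
    · intro j _ hj
      exact Set.indicator_of_notMem (fun hb => hj (hB j i b hb hi)) _
    · simp
  · push Not at h
    rw [Finset.sum_eq_zero fun i _ => Set.indicator_of_notMem (h i) _]
    positivity

/-- The oracle leaves the query register unchanged. -/
theorem restrict_preimage_oracle {X W : Type} (f : X → ℝ) (S : Set X) (φ : HSpace (Label X W)) :
    restrict (Prod.fst ⁻¹' S) (oracle f φ) = oracle f (restrict (Prod.fst ⁻¹' S) φ) := by
  ext b
  rfl

theorem oracle_restrict_congr {X W : Type} {f g : X → ℝ} {S : Set X} (h : ∀ x ∈ S, f x = g x)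
    (φ : HSpace (Label X W)) :
    oracle f (restrict (Prod.fst ⁻¹' S) φ) = oracle g (restrict (Prod.fst ⁻¹' S) φ) := by
  ext ⟨x, y, w⟩
  change Set.indicator _ _ (x, y - f x, w) = Set.indicator _ _ (x, y - g x, w)
  by_cases hx : x ∈ S
  · rw [h x hx]
  · rw [Set.indicator_of_notMem (by simpa using hx), Set.indicator_of_notMem (by simpa using hx)]

namespace Algorithm

variable {X Y : Type}

theorem norm_state (A : Algorithm X Y) (f : X → ℝ) (k : ℕ) : ‖A.state f k‖ = 1 := by
  induction k with
  | zero => simp [state, norm_ket]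
  | succ k ih => simp [state, ih]

theorem prob_eq_norm_restrict_sq (A : Algorithm X Y) (f : X → ℝ) (G : Set Y) :
    A.prob f G = ‖restrict (A.output ⁻¹' G) (A.finalState f)‖ ^ 2 := by
  rw [norm_restrict_sq, prob]
  exact tsum_subtype (A.output ⁻¹' G) (fun b => ‖A.finalState f b‖ ^ 2)

theorem prob_mono (A : Algorithm X Y) (f : X → ℝ) {G G' : Set Y} (h : G ⊆ G') :
    A.prob f G ≤ A.prob f G' := by
  rw [prob_eq_norm_restrict_sq, prob_eq_norm_restrict_sq, norm_restrict_sq, norm_restrict_sq]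
  refine Summable.tsum_le_tsum (fun b => ?_) ((summable_norm_sq _).indicator _)
    ((summable_norm_sq _).indicator _)
  exact Set.indicator_le_indicator_of_subset (Set.preimage_mono h) (fun b => by positivity) b

end Algorithm

end QuantumQuery

/-! ### Effect of one query on inner products -/

namespace QuantumQuery

theorem restrict_eq_add_lt_add_gt {X W : Type} (f g : X → ℝ) (φ : HSpace (Label X W)) :
    φ = restrict (Prod.fst ⁻¹' {x | f x = g x}) φ + (restrict (Prod.fst ⁻¹' {x | f x < g x}) φ +
      restrict (Prod.fst ⁻¹' {x | g x < f x}) φ) := by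
  ext b
  change φ b = Set.indicator _ _ b + (Set.indicator _ _ b + Set.indicator _ _ b)
  rcases lt_trichotomy (f b.1) (g b.1) with h | h | h
  · simp [h, h.ne, h.not_gt]
  · simp [h]
  · simp [h, h.ne', h.not_gt]

/-- Projecting to query points in `S` commutes with the oracles, so both inner products involve only
the parts over `S`; Cauchy–Schwarz bounds each. -/
theorem norm_inner_oracle_restrict_sub_le {X W : Type} (f g : X → ℝ) (S : Set X)
    (φ ψ : HSpace (Label X W)) :
    ‖inner ℂ (oracle f φ) (oracle g (restrict (Prod.fst ⁻¹' S) ψ)) -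
        inner ℂ φ (restrict (Prod.fst ⁻¹' S) ψ)‖ ≤
      2 * (‖restrict (Prod.fst ⁻¹' S) φ‖ * ‖restrict (Prod.fst ⁻¹' S) ψ‖) := by
  have h1 : inner ℂ (oracle f φ) (oracle g (restrict (Prod.fst ⁻¹' S) ψ)) =
      inner ℂ (oracle f (restrict (Prod.fst ⁻¹' S) φ))
        (oracle g (restrict (Prod.fst ⁻¹' S) ψ)) := by
    rw [← restrict_preimage_oracle, inner_restrict_right, restrict_preimage_oracle,
      restrict_preimage_oracle]
  rw [h1, inner_restrict_right]
  refine (norm_sub_le _ _).trans ?_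
  have h2 := norm_inner_le_norm (𝕜 := ℂ) (oracle f (restrict (Prod.fst ⁻¹' S) φ))
    (oracle g (restrict (Prod.fst ⁻¹' S) ψ))
  have h3 := norm_inner_le_norm (𝕜 := ℂ) (restrict (Prod.fst ⁻¹' S) φ)
    (restrict (Prod.fst ⁻¹' S) ψ)
  rw [LinearIsometryEquiv.norm_map, LinearIsometryEquiv.norm_map] at h2
  linarith

/-- One query changes the inner product of two states only through the parts of the states that
query points where the two functions differ. -/
theorem norm_inner_oracle_sub_le {X W : Type} (f g : X → ℝ) (φ ψ : HSpace (Label X W)) :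
    ‖inner ℂ (oracle f φ) (oracle g ψ) - inner ℂ φ ψ‖ ≤
      2 * (‖restrict (Prod.fst ⁻¹' {x | f x < g x}) φ‖ *
          ‖restrict (Prod.fst ⁻¹' {x | f x < g x}) ψ‖) +
        2 * (‖restrict (Prod.fst ⁻¹' {x | g x < f x}) φ‖ *
          ‖restrict (Prod.fst ⁻¹' {x | g x < f x}) ψ‖) := by
  have h := restrict_eq_add_lt_add_gt f g ψ
  -- Where `f` and `g` agree the two oracles act as one unitary, so this part cancels from the
  -- difference.
  have hE : oracle g (restrict (Prod.fst ⁻¹' {x | f x = g x}) ψ) =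
      oracle f (restrict (Prod.fst ⁻¹' {x | f x = g x}) ψ) :=
    (oracle_restrict_congr (fun _ hx => hx) ψ).symm
  have key : inner ℂ (oracle f φ) (oracle g ψ) - inner ℂ φ ψ =
      (inner ℂ (oracle f φ) (oracle g (restrict (Prod.fst ⁻¹' {x | f x < g x}) ψ)) -
        inner ℂ φ (restrict (Prod.fst ⁻¹' {x | f x < g x}) ψ)) +
      (inner ℂ (oracle f φ) (oracle g (restrict (Prod.fst ⁻¹' {x | g x < f x}) ψ)) -
        inner ℂ φ (restrict (Prod.fst ⁻¹' {x | g x < f x}) ψ)) := by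
    conv_lhs => rw [h]
    simp only [map_add, inner_add_right]
    rw [hE, LinearIsometryEquiv.inner_map_map]
    ring
  rw [key]
  exact (norm_add_le _ _).trans (add_le_add (norm_inner_oracle_restrict_sub_le f g _ φ ψ)
    (norm_inner_oracle_restrict_sub_le f g _ φ ψ))

/-- States that are likely to be found in disjoint sets of labels are far from parallel. -/
theorem norm_inner_le_of_disjoint {ι : Type} {B B' : Set ι} (hB : Disjoint B B')
    {φ ψ : HSpace ι} (hφ : ‖φ‖ = 1) (hψ : ‖ψ‖ = 1)
    (h : 9 / 10 ≤ ‖restrict B φ‖ ^ 2) (h' : 9 / 10 ≤ ‖restrict B' ψ‖ ^ 2) :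
    ‖inner ℂ φ ψ‖ ≤ 13 / 20 := by
  have hdec : inner ℂ φ ψ = inner ℂ (restrict B φ) (restrict B ψ) +
      inner ℂ (restrict Bᶜ φ) (restrict Bᶜ ψ) := by
    rw [← inner_restrict_left, ← inner_restrict_left, ← inner_add_left,
      restrict_add_restrict_compl]
  have hsum : ‖restrict B ψ‖ ^ 2 + ‖restrict B' ψ‖ ^ 2 ≤ 1 := by
    have := sum_norm_restrict_sq_le (fun b : Bool => if b then B else B') (by
      intro i j b hi hj
      cases i <;> cases j <;> simp at hi hj ⊢
      · exact Set.disjoint_left.1 hB hj hi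
      · exact Set.disjoint_left.1 hB hi hj) ψ
    simpa [hψ] using this
  have h1 := norm_inner_le_norm (𝕜 := ℂ) (restrict B φ) (restrict B ψ)
  have h2 := norm_inner_le_norm (𝕜 := ℂ) (restrict Bᶜ φ) (restrict Bᶜ ψ)
  have h3 := norm_restrict_sq_add_compl B φ
  rw [hφ] at h3
  -- `13/40` is a rational upper bound for `√(1/10)`; the two summands of `hdec` each contribute it
  -- once.
  have bd : ∀ t : ℝ, t ^ 2 ≤ 1 / 10 → t ≤ 13 / 40 := fun t ht => by nlinarith
  have h4 : ‖restrict B ψ‖ ≤ 13 / 40 := bd _ (by linarith)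
  have h5 : ‖restrict Bᶜ φ‖ ≤ 13 / 40 := bd _ (by linarith)
  have h6 : ‖restrict B φ‖ ≤ 1 := hφ ▸ norm_restrict_le B φ
  have h7 : ‖restrict Bᶜ ψ‖ ≤ 1 := hψ ▸ norm_restrict_le Bᶜ ψ
  rw [hdec]
  refine (norm_add_le _ _).trans ?_
  nlinarith [norm_nonneg (restrict B φ), norm_nonneg (restrict B ψ),
    norm_nonneg (restrict Bᶜ φ), norm_nonneg (restrict Bᶜ ψ)]

end QuantumQuery

/-! ### Adversary lower bound -/

namespace MaxNorm

open QuantumQuery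

variable {n : ℕ}

/-- The bit string `c` with its `i`-th bit flipped. -/
def flip (c : Fin n → Bool) (i : Fin n) : Fin n → Bool := Function.update c i (!c i)

theorem flip_flip (c : Fin n → Bool) (i : Fin n) : flip (flip c i) i = c := by
  simp [flip]

theorem flip_same (c : Fin n → Bool) (i : Fin n) : flip c i i = !c i := by
  simp [flip]

theorem flip_of_ne (c : Fin n → Bool) {i k : Fin n} (h : k ≠ i) : flip c i k = c k := by
  simp [flip, h]

theorem flip_ne (c : Fin n → Bool) (i : Fin n) : flip c i ≠ c := fun h => by
  have := congrFun h i
  simp [flip] at this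

theorem sum_flip (i : Fin n) (F : (Fin n → Bool) → ℝ) : ∑ c, F (flip c i) = ∑ c, F c :=
  Equiv.sum_comp (Function.Involutive.toPerm (fun c => flip c i) fun c => flip_flip c i) F

theorem abs_sub_le_iSup (c : Fin n → Bool) (x : Fin n → ℝ) (k : Fin n) :
    |proj (x k) - corner c k| ≤ ⨆ i, |proj (x i) - corner c i| :=
  le_ciSup (f := fun i => |proj (x i) - corner c i|) (Set.finite_range _).bddAbove k

/-- If the maximum for `c` is attained at `k`, flipping any other bit leaves that term in place, so
the maximum cannot drop. The penalty sum does not depend on `c`, so points outside the cube are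
covered too. -/
theorem eq_of_objective_flip_lt [Nonempty (Fin n)] {c : Fin n → Bool} {x : Fin n → ℝ}
    {i j : Fin n} (hi : objective (flip c i) x < objective c x)
    (hj : objective (flip c j) x < objective c x) : i = j := by
  obtain ⟨k, hk⟩ := exists_eq_ciSup_of_finite (f := fun i => |proj (x i) - corner c i|)
  have key : ∀ i, objective (flip c i) x < objective c x → k = i := by
    intro i hi
    by_contra hne
    have h := abs_sub_le_iSup (flip c i) x k
    rw [show corner (flip c i) k = corner c k by simp [corner, flip_of_ne c hne]] at h
    simp only [objective, ← hk] at hi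
    linarith
  rw [← key i hi, ← key j hj]

theorem proj_eq_self {t : ℝ} (h0 : 0 ≤ t) (h1 : t ≤ 1) : proj t = t := by
  simp [proj, h0.not_gt, h1]

theorem corner_mem_cube (c : Fin n → Bool) : corner c ∈ cube n := fun i => by
  by_cases h : c i <;> simp [corner, h]

theorem objective_of_mem_cube (c : Fin n → Bool) {x : Fin n → ℝ} (hx : x ∈ cube n) :
    objective c x = ⨆ i, |x i - corner c i| := by
  simp [objective, fun i => proj_eq_self (hx i).1 (hx i).2]

theorem objective_corner (c : Fin n → Bool) : objective c (corner c) = 0 := by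
  simp [objective_of_mem_cube c (corner_mem_cube c)]

theorem corner_mem_approxMinimizers (c : Fin n → Bool) :
    corner c ∈ approxMinimizers c (1 / 3) := by
  refine ⟨corner_mem_cube c, fun z hz => ?_⟩
  rw [objective_corner, objective_of_mem_cube c hz]
  have : 0 ≤ ⨆ i, |z i - corner c i| := Real.iSup_nonneg fun i => abs_nonneg _
  linarith

/-- The minimum is 0, so a common point would have a coordinate within `1/3` of both 0 and 1. -/
theorem disjoint_approxMinimizers {c c' : Fin n → Bool} (h : c ≠ c') :
    Disjoint (approxMinimizers c (1 / 3)) (approxMinimizers c' (1 / 3)) := by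
  rw [Set.disjoint_left]
  rintro x ⟨hx, h1⟩ ⟨-, h2⟩
  obtain ⟨i, hi⟩ := Function.ne_iff.1 h
  have key : ∀ c : Fin n → Bool, (∀ z ∈ cube n, objective c x ≤ objective c z + 1 / 3) →
      |x i - corner c i| ≤ 1 / 3 := fun c hc => by
    have h3 := hc _ (corner_mem_cube c)
    rw [objective_corner, objective] at h3
    have h4 := abs_sub_le_iSup c x i
    have h5 : 0 ≤ ∑ i, |proj (x i) - x i| := Finset.sum_nonneg fun i _ => abs_nonneg _
    rw [proj_eq_self (hx i).1 (hx i).2] at h4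
    linarith
  have h3 := abs_le.1 (key c h1)
  have h4 := abs_le.1 (key c' h2)
  cases hc : c i <;> cases hc' : c' i <;> simp [corner, hc, hc'] at h3 h4 hi <;> linarith

/-- In each product one factor is only bounded by 1, while the squares of the other sum to at most 1
over the neighbours of an input, by disjointness. AM–GM weighted by `√n` balances `n` against 1. -/
theorem sum_norm_mul_norm_restrict_le [Nonempty (Fin n)] {D : Set (Fin n → ℝ)} {W : Type}
    (φ : (Fin n → Bool) → HSpace (Label D W)) (hφ : ∀ c, ‖φ c‖ = 1) :
    ∑ c, ∑ i, ‖restrict (Prod.fst ⁻¹' {x | evalOn D c x < evalOn D (flip c i) x}) (φ c)‖ *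
        ‖restrict (Prod.fst ⁻¹' {x | evalOn D c x < evalOn D (flip c i) x}) (φ (flip c i))‖ ≤
      ∑ _c : Fin n → Bool, Real.sqrt n := by
  have hn : 0 < (n : ℝ) := by
    have : 0 < n := Fin.pos_iff_nonempty.2 inferInstance
    exact_mod_cast this
  have hs : 0 < Real.sqrt n := Real.sqrt_pos.2 hn
  have hss : Real.sqrt n * Real.sqrt n = n := Real.mul_self_sqrt hn.le
  have am : ∀ a b : ℝ, a * b ≤ a ^ 2 / (2 * Real.sqrt n) + Real.sqrt n / 2 * b ^ 2 := by
    intro a b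
    have h1 : a ^ 2 / (2 * Real.sqrt n) + Real.sqrt n / 2 * b ^ 2 - a * b =
        (a - Real.sqrt n * b) ^ 2 / (2 * Real.sqrt n) := by field_simp; ring
    have h2 : 0 ≤ (a - Real.sqrt n * b) ^ 2 / (2 * Real.sqrt n) := by positivity
    linarith
  refine (Finset.sum_le_sum fun c _ => Finset.sum_le_sum fun i _ => am _ _).trans ?_
  simp only [Finset.sum_add_distrib]
  have e1 : ∀ c, ∑ i, ‖restrict (Prod.fst ⁻¹' {x | evalOn D c x < evalOn D (flip c i) x})
      (φ c)‖ ^ 2 / (2 * Real.sqrt n) ≤ Real.sqrt n / 2 := by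
    intro c
    have : ∀ i ∈ Finset.univ, ‖restrict (Prod.fst ⁻¹'
        {x | evalOn D c x < evalOn D (flip c i) x}) (φ c)‖ ^ 2 / (2 * Real.sqrt n) ≤
        1 / (2 * Real.sqrt n) := fun i _ => by
      gcongr
      have h1 := norm_restrict_le (Prod.fst ⁻¹'
        {x | evalOn D c x < evalOn D (flip c i) x}) (φ c)
      rw [hφ] at h1
      exact pow_le_one₀ (norm_nonneg _) h1
    refine (Finset.sum_le_sum this).trans (le_of_eq ?_)
    simp only [Finset.sum_const, Finset.card_univ, Fintype.card_fin, nsmul_eq_mul]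
    rw [← hss]
    simp only [Real.sqrt_mul_self hs.le]
    field_simp
  have e2 : ∑ c, ∑ i, Real.sqrt n / 2 *
      ‖restrict (Prod.fst ⁻¹' {x | evalOn D c x < evalOn D (flip c i) x}) (φ (flip c i))‖ ^ 2 ≤
      ∑ _c : Fin n → Bool, Real.sqrt n / 2 := by
    rw [Finset.sum_comm]
    -- After `c ↦ flip c i` the sets are those where flipping bit `i` decreases the objective, which
    -- are disjoint for different `i`.
    have : ∀ i, ∑ c, Real.sqrt n / 2 * ‖restrict (Prod.fst ⁻¹'
          {x | evalOn D c x < evalOn D (flip c i) x}) (φ (flip c i))‖ ^ 2 =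
        ∑ c, Real.sqrt n / 2 * ‖restrict (Prod.fst ⁻¹'
          {x | evalOn D (flip c i) x < evalOn D c x}) (φ c)‖ ^ 2 := fun i => by
      rw [← sum_flip i (fun c => Real.sqrt n / 2 * ‖restrict (Prod.fst ⁻¹'
          {x | evalOn D (flip c i) x < evalOn D c x}) (φ c)‖ ^ 2)]
      simp only [flip_flip]
    simp only [this]
    rw [Finset.sum_comm]
    refine Finset.sum_le_sum fun c _ => ?_
    rw [← Finset.mul_sum]
    have h1 := sum_norm_restrict_sq_le (fun i => (Prod.fst ⁻¹'
      {x | evalOn D (flip c i) x < evalOn D c x} : Set (Label D W)))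
      (fun i j b hi hj => eq_of_objective_flip_lt hi hj) (φ c)
    rw [hφ] at h1
    nlinarith
  refine (add_le_add (Finset.sum_le_sum fun c _ => e1 c) e2).trans (le_of_eq ?_)
  rw [← Finset.sum_add_distrib]
  simp

/-- The adversary lower bound for max-norm optimization. -/
theorem sqrt_le_queries_of_solves [Nonempty (Fin n)] {D : Set (Fin n → ℝ)} (A : Solver D)
    (hA : Solves A) : 7 / 80 * Real.sqrt n ≤ A.queries := by
  have hn : 0 < (n : ℝ) := by
    have : 0 < n := Fin.pos_iff_nonempty.2 inferInstance
    exact_mod_cast this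
  have hs : 0 < Real.sqrt n := Real.sqrt_pos.2 hn
  have hss : Real.sqrt n * Real.sqrt n = n := Real.mul_self_sqrt hn.le
  let φ : ℕ → (Fin n → Bool) → HSpace (Label D A.W) := fun k c => A.state (evalOn D c) k
  let P : ℕ → ℝ := fun k => ∑ c, ∑ i, (inner ℂ (φ k c) (φ k (flip c i)) : ℂ).re
  let N : ℝ := ∑ _c : Fin n → Bool, (1 : ℝ)
  have hN : 0 < N := Finset.sum_pos (fun _ _ => one_pos) Finset.univ_nonempty
  have hconst : ∀ t : ℝ, ∑ _c : Fin n → Bool, t = N * t := fun t => by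
    rw [Finset.sum_mul]; simp
  have hφ : ∀ k c, ‖φ k c‖ = 1 := fun k c => A.norm_state _ k
  have h0 : P 0 = N * n := by
    rw [← hconst]
    refine Finset.sum_congr rfl fun c _ => ?_
    have : ∀ i, (inner ℂ (φ 0 c) (φ 0 (flip c i)) : ℂ).re = 1 := fun i => by
      have h1 : φ 0 (flip c i) = φ 0 c := rfl
      have h2 := inner_self_eq_norm_sq (𝕜 := ℂ) (φ 0 c)
      rw [hφ] at h2
      rw [h1]
      simpa using h2
    simp [this]
  have hT : P A.queries ≤ N * (13 / 20 * n) := by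
    rw [← hconst]
    refine Finset.sum_le_sum fun c _ => ?_
    have : ∀ i ∈ Finset.univ,
        (inner ℂ (φ A.queries c) (φ A.queries (flip c i)) : ℂ).re ≤ 13 / 20 := fun i _ => by
      refine (Complex.re_le_norm _).trans (norm_inner_le_of_disjoint
        (B := A.output ⁻¹' approxMinimizers c (1 / 3))
        (B' := A.output ⁻¹' approxMinimizers (flip c i) (1 / 3))
        ((disjoint_approxMinimizers (flip_ne c i).symm).preimage _) (hφ _ _) (hφ _ _) ?_ ?_)
      · exact (hA c).trans_eq (A.prob_eq_norm_restrict_sq _ _)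
      · exact (hA _).trans_eq (A.prob_eq_norm_restrict_sq _ _)
    refine (Finset.sum_le_sum this).trans (le_of_eq ?_)
    simp [mul_comm]
  have hstep : ∀ k, P k - P (k + 1) ≤ N * (4 * Real.sqrt n) := by
    intro k
    let F : (Fin n → Bool) → Fin n → ℝ := fun c i =>
      ‖restrict (Prod.fst ⁻¹' {x | evalOn D c x < evalOn D (flip c i) x}) (φ k c)‖ *
        ‖restrict (Prod.fst ⁻¹' {x | evalOn D c x < evalOn D (flip c i) x}) (φ k (flip c i))‖
    have hF : ∑ c, ∑ i, F c i ≤ N * Real.sqrt n := by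
      rw [← hconst]; exact sum_norm_mul_norm_restrict_le (φ k) (hφ k)
    -- The opposite sign of the difference is the same edge seen from its other endpoint.
    have hF' : ∑ c, ∑ i, F (flip c i) i = ∑ c, ∑ i, F c i := by
      rw [Finset.sum_comm, Finset.sum_comm (f := fun c i => F c i)]
      exact Finset.sum_congr rfl fun i _ => sum_flip i (fun c => F c i)
    have hpt : ∀ c i, (inner ℂ (φ k c) (φ k (flip c i)) : ℂ).re -
        (inner ℂ (φ (k + 1) c) (φ (k + 1) (flip c i)) : ℂ).re ≤
        2 * F c i + 2 * F (flip c i) i := by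
      intro c i
      have h1 : inner ℂ (φ (k + 1) c) (φ (k + 1) (flip c i)) =
          inner ℂ (oracle (evalOn D c) (φ k c)) (oracle (evalOn D (flip c i)) (φ k (flip c i))) :=
        LinearIsometryEquiv.inner_map_map _ _ _
      have h2 := norm_inner_oracle_sub_le (evalOn D c) (evalOn D (flip c i)) (φ k c)
        (φ k (flip c i))
      rw [← h1, ← norm_neg, neg_sub] at h2
      have h3 := (Complex.re_le_norm _).trans h2
      rw [Complex.sub_re] at h3
      refine h3.trans (le_of_eq ?_)
      simp only [F, flip_flip]
      ring
    calc P k - P (k + 1) = ∑ c, ∑ i, ((inner ℂ (φ k c) (φ k (flip c i)) : ℂ).re -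
          (inner ℂ (φ (k + 1) c) (φ (k + 1) (flip c i)) : ℂ).re) := by
          simp only [P, Finset.sum_sub_distrib]
      _ ≤ ∑ c, ∑ i, (2 * F c i + 2 * F (flip c i) i) :=
          Finset.sum_le_sum fun c _ => Finset.sum_le_sum fun i _ => hpt c i
      _ = 4 * ∑ c, ∑ i, F c i := by
          simp only [Finset.sum_add_distrib, ← Finset.mul_sum, hF']; ring
      _ ≤ N * (4 * Real.sqrt n) := by linarith
  have htot : ∀ k : ℕ, P 0 - P k ≤ k * (N * (4 * Real.sqrt n)) := by
    intro k
    induction k with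
    | zero => simp
    | succ k ih => push_cast; linarith [hstep k]
  have h1 := htot A.queries
  rw [h0] at h1
  have h2 : N * (7 / 20 * n) ≤ N * (A.queries * (4 * Real.sqrt n)) := by linarith
  have h3 := le_of_mul_le_mul_left h2 hN
  rw [← hss] at h3
  simp only [Real.sqrt_mul_self hs.le] at h3
  nlinarith

end MaxNorm

/-! ### Algorithms from dual adversary solutions -/

namespace QuantumQuery

open Classical in
theorem inner_sum_smul_ket {X I : Type} [Fintype I] (p : I → X) (y y' : I → ℝ) (a a' : I → ℝ) :
    inner ℂ (∑ i, (a i : ℂ) • ket ((p i, y i, i) : Label X I))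
        (∑ i, (a' i : ℂ) • ket ((p i, y' i, i) : Label X I)) =
      ((∑ i, if y i = y' i then a i * a' i else 0 : ℝ) : ℂ) := by
  simp only [sum_inner, inner_sum, inner_smul_left, inner_smul_right, inner_ket, Prod.mk.injEq]
  push_cast
  refine Finset.sum_congr rfl fun i _ => ?_
  rw [Finset.sum_eq_single i]
  · by_cases h : y i = y' i <;> simp [h, mul_comm]
  · intro j _ hj
    simp [hj]
  · simp

section AdversaryAlgorithm

variable {X C J : Type} [Fintype C] [Fintype J]

open Classical in
/-- Coefficients of the ideal state of the adversary algorithm after `k` of `K` queries. The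
label `none` stands for "output unknown", `some d` for "output `d`", and the labels in `J` carry
the catalyst `v c`. -/
noncomputable def idealCoeff (K : ℕ) (v : C → J → ℝ) (k : ℕ) (c : C) : Option C ⊕ J → ℝ
  | .inl none => Real.sqrt ((K - k : ℝ) / K)
  | .inl (some d) => if d = c then Real.sqrt (k / K) else 0
  | .inr j => v c j / Real.sqrt K

/-- The query point that goes with each workspace label. -/
def queryPoint (x₀ : X) (x : J → X) : Option C ⊕ J → X := Sum.elim (fun _ => x₀) x

/-- The ideal state after `k` of `K` queries. -/
noncomputable def idealState (x₀ : X) (x : J → X) (K : ℕ) (v : C → J → ℝ) (k : ℕ) (c : C) :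
    HSpace (Label X (Option C ⊕ J)) :=
  ∑ i, (idealCoeff K v k c i : ℂ) • ket (queryPoint x₀ x i, 0, i)

theorem oracle_idealState (f : X → ℝ) (x₀ : X) (x : J → X) (K : ℕ) (v : C → J → ℝ) (k : ℕ)
    (c : C) :
    oracle f (idealState x₀ x K v k c) = ∑ i, (idealCoeff K v k c i : ℂ) •
      ket (queryPoint x₀ x i, f (queryPoint x₀ x i), i) := by
  simp only [idealState, map_sum, map_smul, oracle_ket, zero_add]

-- For `c ≠ c'` the query removes `1/K` from the catalyst overlap, by feasibility; passing from `k`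
-- to `k + 1` removes the same amount from the overlap on `none`. For `c = c'` the weights on `none`
-- and `some c` add up to 1 throughout.
open Classical in
theorem inner_idealState_succ {f : C → X → ℝ} {x₀ : X} (hx₀ : ∀ c c', f c x₀ = f c' x₀)
    {x : J → X} {v : C → J → ℝ}
    (hv : ∀ c c', c ≠ c' → ∑ j, (if f c (x j) ≠ f c' (x j) then v c j * v c' j else 0) = 1)
    {K k : ℕ} (hk : k < K) (c c' : C) :
    inner ℂ (oracle (f c) (idealState x₀ x K v k c)) (oracle (f c') (idealState x₀ x K v k c')) =
      inner ℂ (idealState x₀ x K v (k + 1) c) (idealState x₀ x K v (k + 1) c') := by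
  have hK : (0 : ℝ) < K := by exact_mod_cast (Nat.zero_le k).trans_lt hk
  have hk' : (k : ℝ) + 1 ≤ K := by exact_mod_cast hk
  rw [oracle_idealState, oracle_idealState, idealState, idealState, inner_sum_smul_ket,
    inner_sum_smul_ket]
  congr 1
  simp only [Fintype.sum_sum_type, Fintype.sum_option, queryPoint, Sum.elim_inl, Sum.elim_inr,
    idealCoeff, hx₀ c c', if_true]
  have h1 : ∀ m : ℕ, (m : ℝ) ≤ K → Real.sqrt ((K - m : ℝ) / K) * Real.sqrt ((K - m : ℝ) / K) =
      (K - m : ℝ) / K := fun m hm =>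
    Real.mul_self_sqrt (div_nonneg (by linarith) hK.le)
  have h2 : ∀ m : ℕ, (∑ d, (if d = c then Real.sqrt ((m : ℝ) / K) else 0) *
      (if d = c' then Real.sqrt ((m : ℝ) / K) else 0)) = if c = c' then (m : ℝ) / K else 0 := by
    intro m
    rw [Finset.sum_eq_single c]
    · by_cases h : c = c'
      · simp only [h, if_true]
        exact Real.mul_self_sqrt (div_nonneg (Nat.cast_nonneg m) hK.le)
      · simp [h]
    · intro d _ hd
      simp [hd]
    · simp
  have h3 : ∀ j, v c j / Real.sqrt K * (v c' j / Real.sqrt K) = v c j * v c' j / K := by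
    intro j
    rw [div_mul_div_comm, Real.mul_self_sqrt hK.le]
  rw [h1 k (by linarith), h1 (k + 1) (by push_cast; linarith), h2, h2]
  simp only [h3]
  push_cast
  by_cases h : c = c'
  · subst h
    simp only [if_true]
    field_simp
    ring
  · have h4 : ∑ j, (if f c (x j) = f c' (x j) then v c j * v c' j / K else 0) =
        ∑ j, v c j * v c' j / K - 1 / K := by
      rw [← hv c c' h, Finset.sum_div, ← Finset.sum_sub_distrib]
      refine Finset.sum_congr rfl fun j _ => ?_
      by_cases hf : f c (x j) = f c' (x j) <;> simp [hf]
    simp only [h, if_false]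
    rw [h4]
    field_simp
    ring

theorem norm_idealState_zero_sub_sq {x₀ : X} {x : J → X} {v : C → J → ℝ} {K : ℕ} (hK : 0 < K)
    (c : C) : ‖ket (x₀, 0, .inl none) - idealState x₀ x K v 0 c‖ ^ 2 = (∑ j, v c j ^ 2) / K := by
  have hK' : (0 : ℝ) < K := by exact_mod_cast hK
  have h1 : ket (x₀, 0, .inl none) - idealState x₀ x K v 0 c =
      -∑ i : Option C ⊕ J, ((Sum.elim (fun _ => 0) (fun j => v c j / Real.sqrt K) i : ℝ) : ℂ) •
        ket (queryPoint x₀ x i, 0, i) := by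
    simp [idealState, Fintype.sum_sum_type, Fintype.sum_option, idealCoeff, queryPoint, hK'.ne',
      -Complex.coe_smul]
  rw [h1, norm_neg, ← inner_self_eq_norm_sq (𝕜 := ℂ), inner_sum_smul_ket]
  refine (Complex.ofReal_re _).trans ?_
  simp only [Fintype.sum_sum_type, Sum.elim_inl, Sum.elim_inr, if_true, mul_zero,
    Finset.sum_const_zero, zero_add]
  rw [Finset.sum_div]
  refine Finset.sum_congr rfl fun j _ => ?_
  rw [div_mul_div_comm, Real.mul_self_sqrt hK'.le, sq]

theorem idealState_apply_output {x₀ : X} {x : J → X} {v : C → J → ℝ} {K : ℕ} (hK : 0 < K)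
    (c : C) : idealState x₀ x K v K c (x₀, 0, .inl (some c)) = 1 := by
  classical
  have hK' : (K : ℝ) ≠ 0 := by exact_mod_cast hK.ne'
  rw [← inner_ket_left, idealState, inner_sum, Finset.sum_eq_single (.inl (some c))]
  · rw [inner_smul_right, inner_ket]
    simp [queryPoint, idealCoeff, hK']
  · intro i _ hi
    rw [inner_smul_right, inner_ket]
    simp [hi.symm]
  · simp

open Classical in
/-- A feasible solution `v` of the dual adversary problem with objective value `M` gives a quantum
algorithm with `K ≥ 400 M` queries. -/
theorem exists_algorithm_of_dual_adversary {Y : Type} [Nonempty Y] {f : C → X → ℝ} {x₀ : X}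
    (hx₀ : ∀ c c', f c x₀ = f c' x₀) {x : J → X} {v : C → J → ℝ}
    (hv : ∀ c c', c ≠ c' → ∑ j, (if f c (x j) ≠ f c' (x j) then v c j * v c' j else 0) = 1)
    {M : ℝ} (hM : ∀ c, ∑ j, v c j ^ 2 ≤ M) {K : ℕ} (hK : 0 < K) (hMK : 400 * M ≤ K)
    (out : C → Y) :
    ∃ A : Algorithm X Y, A.queries = K ∧ ∀ c, 9 / 10 ≤ A.prob (f c) {out c} := by
  have hK' : (0 : ℝ) < K := by exact_mod_cast hK
  have hU : ∀ k, ∃ U : HSpace (Label X (Option C ⊕ J)) ≃ₗᵢ[ℂ] HSpace (Label X (Option C ⊕ J)),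
      k < K → ∀ c, U (oracle (f c) (idealState x₀ x K v k c)) = idealState x₀ x K v (k + 1) c := by
    intro k
    by_cases hk : k < K
    · obtain ⟨U, hU⟩ := exists_linearIsometryEquiv_of_inner_eq
        (inner_idealState_succ hx₀ hv hk)
      exact ⟨U, fun _ => hU⟩
    · exact ⟨LinearIsometryEquiv.refl ℂ _, fun h => absurd h hk⟩
  choose U hU using hU
  let A : Algorithm X Y :=
    { W := Option C ⊕ J
      queries := K
      init := (x₀, 0, .inl none)
      -- Index shift: the unitary following query `k + 1` is `U k`, and nothing is done before the
      -- first query.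
      U := fun k => Nat.casesOn k (LinearIsometryEquiv.refl ℂ _) U
      output := fun b => Sum.elim (fun d => d.elim (Classical.arbitrary Y) out)
        (fun _ => Classical.arbitrary Y) b.2.2 }
  refine ⟨A, rfl, fun c => ?_⟩
  -- The true and the ideal state undergo the same unitaries, so their distance stays that of the
  -- missing catalyst.
  have hdist : ∀ k ≤ K, ‖A.state (f c) k - idealState x₀ x K v k c‖ ^ 2 ≤ M / K := by
    intro k
    induction k with
    | zero =>
      intro _
      change ‖ket (x₀, 0, .inl none) - idealState x₀ x K v 0 c‖ ^ 2 ≤ _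
      rw [norm_idealState_zero_sub_sq hK]
      gcongr
      exact hM c
    | succ k ih =>
      intro hk
      rw [← hU k hk c]
      change ‖U k (oracle (f c) (A.state (f c) k)) - _‖ ^ 2 ≤ _
      rw [← map_sub, ← map_sub, LinearIsometryEquiv.norm_map, LinearIsometryEquiv.norm_map]
      exact ih (Nat.le_of_succ_le hk)
  have h1 : ‖A.finalState (f c) - idealState x₀ x K v K c‖ ≤ 1 / 20 := by
    refine abs_le_of_sq_le_sq' ((hdist K le_rfl).trans ?_) (by norm_num) |>.2
    rw [div_le_iff₀ hK']
    linarith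
  set b : Label X (Option C ⊕ J) := (x₀, 0, .inl (some c)) with hb
  have h2 : ‖A.finalState (f c) b - 1‖ ≤ 1 / 20 := by
    have h3 := (norm_apply_le (A.finalState (f c) - idealState x₀ x K v K c) b).trans h1
    have h4 : (A.finalState (f c) - idealState x₀ x K v K c) b =
        A.finalState (f c) b - idealState x₀ x K v K c b := rfl
    rwa [h4, hb, idealState_apply_output hK] at h3
  have h3 : 19 / 20 ≤ ‖A.finalState (f c) b‖ := by
    have h4 := norm_sub_norm_le (1 : ℂ) (A.finalState (f c) b)
    rw [norm_one, norm_sub_rev] at h4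
    linarith
  have h4 : ‖A.finalState (f c) b‖ ^ 2 ≤ A.prob (f c) {out c} :=
    ((summable_norm_sq (A.finalState (f c))).subtype _).le_tsum
      (⟨b, rfl⟩ : {b // A.output b ∈ ({out c} : Set Y)}) fun _ _ => sq_nonneg _
  -- `(19/20)² = 0.9025`, just above the required 0.9.
  nlinarith

end AdversaryAlgorithm

end QuantumQuery

/-! ### Weights on subsets -/

section Weights

/-- With `m = n - |Δ|` and `e = |Δ| - 1`, this sums the weights of the sets `R ∪ {i}`, `R` disjoint
from `Δ`, by the size `r` of `R`. -/
theorem sum_choose_div_mul_choose (m e : ℕ) :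
    ∑ r ∈ Finset.range (m + 1),
      (m.choose r : ℝ) * (1 / ((r + 1 : ℕ) * (m + e + 1).choose (r + 1))) = 1 / (e + 1) := by
  have hterm : ∀ r ∈ Finset.range (m + 1),
      (m.choose r : ℝ) * (1 / ((r + 1 : ℕ) * (m + e + 1).choose (r + 1))) =
        (m + 1 - 1 - r + e).choose e / ((e + 1) * (m + e + 1).choose (e + 1)) := by
    intro r hr
    obtain ⟨j, rfl⟩ := Nat.exists_eq_add_of_le (Nat.lt_succ_iff.1 (Finset.mem_range.1 hr))
    have e1 : r + j + 1 - 1 - r + e = e + j := by omega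
    have e2 : r + j + e + 1 = (r + 1) + (j + e) := by omega
    have e3 : r + j + e + 1 = (e + 1) + (r + j) := by omega
    rw [e1]
    nth_rewrite 1 [e2]
    rw [e3, Nat.cast_add_choose, Nat.cast_add_choose, Nat.cast_add_choose, Nat.cast_add_choose,
      ← e3, ← e2, add_comm e j, Nat.factorial_succ r, Nat.factorial_succ e]
    push_cast
    have h1 : ((r.factorial : ℕ) : ℝ) ≠ 0 := by exact_mod_cast r.factorial_ne_zero
    have h2 : ((j.factorial : ℕ) : ℝ) ≠ 0 := by exact_mod_cast j.factorial_ne_zero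
    have h3 : ((e.factorial : ℕ) : ℝ) ≠ 0 := by exact_mod_cast e.factorial_ne_zero
    have h4 : (((r + j).factorial : ℕ) : ℝ) ≠ 0 := by exact_mod_cast (r + j).factorial_ne_zero
    have h5 : (((j + e).factorial : ℕ) : ℝ) ≠ 0 := by exact_mod_cast (j + e).factorial_ne_zero
    have h6 : (((r + j + e + 1).factorial : ℕ) : ℝ) ≠ 0 := by
      exact_mod_cast (r + j + e + 1).factorial_ne_zero
    field_simp
  -- In this form the numerators run along a diagonal of Pascal's triangle: the hockey-stick
  -- identity.
  rw [Finset.sum_congr rfl hterm, ← Finset.sum_div,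
    Finset.sum_range_reflect (fun j => (((j + e).choose e : ℕ) : ℝ)) (m + 1), ← Nat.cast_sum,
    Nat.sum_range_add_choose]
  have h : (((m + e + 1).choose (e + 1) : ℕ) : ℝ) ≠ 0 := by
    exact_mod_cast (Nat.choose_pos (by omega)).ne'
  field_simp

/-- The weight of a query to the set `S`. -/
noncomputable def queryWeight {n : ℕ} (S : Finset (Fin n)) : ℝ :=
  1 / (S.card * n.choose S.card)

theorem queryWeight_nonneg {n : ℕ} (S : Finset (Fin n)) : 0 ≤ queryWeight S := by
  unfold queryWeight; positivity

theorem sum_queryWeight_inter_eq_singleton {n : ℕ} {Δ : Finset (Fin n)} {i : Fin n}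
    (hi : i ∈ Δ) :
    ∑ S : Finset (Fin n), (if S ∩ Δ = {i} then queryWeight S else 0) = 1 / Δ.card := by
  have hcard : 0 < Δ.card := Finset.card_pos.2 ⟨i, hi⟩
  obtain ⟨e, he⟩ := Nat.exists_eq_succ_of_ne_zero hcard.ne'
  have hle : Δ.card ≤ n := by simpa using Finset.card_le_univ Δ
  have hn : n = (n - Δ.card) + e + 1 := by omega
  have hc : Δᶜ.card = n - Δ.card := by simp [Finset.card_compl]
  rw [← Finset.sum_filter]
  have hbij : ∑ S with S ∩ Δ = {i}, queryWeight S =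
      ∑ R ∈ Δᶜ.powerset, 1 / (((R.card + 1 : ℕ) : ℝ) * n.choose (R.card + 1)) := by
    have hnot : ∀ R ∈ Δᶜ.powerset, i ∉ R := fun R hR hiR =>
      Finset.mem_compl.1 (Finset.mem_powerset.1 hR hiR) hi
    symm
    refine Finset.sum_bij' (fun R _ => insert i R) (fun S _ => S.erase i) ?_ ?_ ?_ ?_ ?_
    · intro R hR
      simp only [Finset.mem_filter, Finset.mem_univ, true_and]
      ext k
      simp only [Finset.mem_inter, Finset.mem_insert, Finset.mem_singleton]
      constructor
      · rintro ⟨rfl | hk, hkΔ⟩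
        · rfl
        · exact absurd hkΔ (Finset.mem_compl.1 (Finset.mem_powerset.1 hR hk))
      · rintro rfl
        exact ⟨Or.inl rfl, hi⟩
    · intro S hS
      simp only [Finset.mem_filter, Finset.mem_univ, true_and] at hS
      refine Finset.mem_powerset.2 fun k hk => Finset.mem_compl.2 fun hkΔ => ?_
      have : k ∈ S ∩ Δ := Finset.mem_inter.2 ⟨Finset.mem_of_mem_erase hk, hkΔ⟩
      rw [hS, Finset.mem_singleton] at this
      exact Finset.ne_of_mem_erase hk this
    · intro R hR
      exact Finset.erase_insert (hnot R hR)
    · intro S hS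
      simp only [Finset.mem_filter, Finset.mem_univ, true_and] at hS
      have : i ∈ S ∩ Δ := by rw [hS]; exact Finset.mem_singleton_self i
      exact Finset.insert_erase (Finset.mem_inter.1 this).1
    · intro R hR
      rw [queryWeight, Finset.card_insert_of_notMem (hnot R hR)]
  rw [hbij, Finset.sum_powerset_apply_card
    (fun r => 1 / (((r + 1 : ℕ) : ℝ) * n.choose (r + 1))), hc, he]
  have h := sum_choose_div_mul_choose (n - Δ.card) e
  rw [← hn, he] at h
  simp only [nsmul_eq_mul]
  rw [h]
  push_cast
  rfl

/-- The feasibility identity for the dual adversary: for a nonempty set `Δ`, the sets that meet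
`Δ` in exactly one point have total weight one. -/
theorem sum_queryWeight_card_inter_eq_one {n : ℕ} {Δ : Finset (Fin n)} (hΔ : Δ.Nonempty) :
    ∑ S : Finset (Fin n), (if (S ∩ Δ).card = 1 then queryWeight S else 0) = 1 := by
  have h : ∀ S : Finset (Fin n), (if (S ∩ Δ).card = 1 then queryWeight S else 0) =
      ∑ i ∈ Δ, if S ∩ Δ = {i} then queryWeight S else 0 := by
    intro S
    by_cases hS : (S ∩ Δ).card = 1
    · obtain ⟨i, hi⟩ := Finset.card_eq_one.1 hS
      have hiΔ : i ∈ Δ := by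
        have : i ∈ S ∩ Δ := hi ▸ Finset.mem_singleton_self i
        exact (Finset.mem_inter.1 this).2
      simp [hi, hiΔ]
    · rw [if_neg hS, Finset.sum_eq_zero]
      intro i _
      rw [if_neg]
      intro hi
      exact hS (by rw [hi, Finset.card_singleton])
  simp only [h]
  rw [Finset.sum_comm, Finset.sum_congr rfl fun i hi => sum_queryWeight_inter_eq_singleton hi]
  have : (Δ.card : ℝ) ≠ 0 := by exact_mod_cast (Finset.card_pos.2 hΔ).ne'
  simp [this]

/-- Telescoping `1/√(n+1) ≤ 2(√(n+1) - √n)`; the term `s = 0` is `0/0 = 0`. -/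
theorem sum_range_sqrt_div_le (n : ℕ) :
    ∑ s ∈ Finset.range (n + 1), Real.sqrt s / s ≤ 2 * Real.sqrt n := by
  induction n with
  | zero => simp
  | succ n ih =>
    rw [Finset.sum_range_succ]
    have h0 : (0 : ℝ) ≤ n := Nat.cast_nonneg n
    have hs : 0 < Real.sqrt (n + 1) := Real.sqrt_pos.2 (by linarith)
    have h1 : Real.sqrt (n + 1) * Real.sqrt (n + 1) = n + 1 := Real.mul_self_sqrt (by linarith)
    have h2 : Real.sqrt n * Real.sqrt n = n := Real.mul_self_sqrt h0
    push_cast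
    have h3 : Real.sqrt (n + 1) / (n + 1) ≤ 2 * Real.sqrt (n + 1) - 2 * Real.sqrt n := by
      rw [div_le_iff₀ (by linarith)]
      nth_rewrite 3 [← h1]
      nlinarith [sq_nonneg (Real.sqrt (n + 1) - Real.sqrt n)]
    linarith

/-- Group by cardinality: the `C(n,s)` sets of size `s` cancel the binomial in the weight. -/
theorem sum_queryWeight_mul_sqrt_le (n : ℕ) :
    ∑ S : Finset (Fin n), queryWeight S * Real.sqrt S.card ≤ 2 * Real.sqrt n := by
  refine le_trans (le_of_eq ?_) (sum_range_sqrt_div_le n)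
  have h := Finset.sum_powerset_apply_card
    (fun s => 1 / ((s : ℝ) * n.choose s) * Real.sqrt s) (x := (Finset.univ : Finset (Fin n)))
  rw [Finset.powerset_univ, Finset.card_univ, Fintype.card_fin] at h
  refine h.trans (Finset.sum_congr rfl fun s hs => ?_)
  have : ((n.choose s : ℕ) : ℝ) ≠ 0 := by
    exact_mod_cast (Nat.choose_pos (Nat.lt_succ_iff.1 (Finset.mem_range.1 hs))).ne'
  rw [nsmul_eq_mul]
  rcases Nat.eq_zero_or_pos s with rfl | h0
  · simp
  · have : (s : ℝ) ≠ 0 := by exact_mod_cast h0.ne'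
    field_simp

end Weights

/-! ### Dual solution for max-norm queries -/

namespace MaxNorm

open QuantumQuery

variable {n : ℕ}

/-- The query that compares the bits in `S` with those of `y`. -/
noncomputable def wildcardPoint (q : Finset (Fin n) × (Fin n → Bool)) : Fin n → ℝ :=
  fun i => if i ∈ q.1 then corner q.2 i else 1 / 2

theorem wildcardPoint_mem_grid (q : Finset (Fin n) × (Fin n → Bool)) :
    wildcardPoint q ∈ grid n := fun i => by
  by_cases h : i ∈ q.1 <;> cases hy : q.2 i <;> simp [wildcardPoint, corner, h, hy]

theorem wildcardPoint_mem_cube (q : Finset (Fin n) × (Fin n → Bool)) :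
    wildcardPoint q ∈ cube n := fun i => by
  by_cases h : i ∈ q.1 <;> cases hy : q.2 i <;> norm_num [wildcardPoint, corner, h, hy]

/-- The positions in `S` where `y` and `c` disagree. -/
def mismatch (q : Finset (Fin n) × (Fin n → Bool)) (c : Fin n → Bool) : Finset (Fin n) :=
  {i ∈ q.1 | q.2 i ≠ c i}

theorem abs_wildcardPoint_sub_corner (q : Finset (Fin n) × (Fin n → Bool)) (c : Fin n → Bool)
    (i : Fin n) : |wildcardPoint q i - corner c i| =
      if i ∈ mismatch q c then 1 else if i ∈ q.1 then 0 else 1 / 2 := by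
  by_cases h : i ∈ q.1 <;> cases hy : q.2 i <;> cases hc : c i <;>
    norm_num [wildcardPoint, corner, mismatch, h, hy, hc]

theorem objective_wildcardPoint_of_nonempty {q : Finset (Fin n) × (Fin n → Bool)}
    {c : Fin n → Bool} (h : (mismatch q c).Nonempty) : objective c (wildcardPoint q) = 1 := by
  obtain ⟨i, hi⟩ := h
  have : Nonempty (Fin n) := ⟨i⟩
  rw [objective_of_mem_cube c (wildcardPoint_mem_cube q)]
  simp only [abs_wildcardPoint_sub_corner]
  refine le_antisymm (ciSup_le fun k => ?_) ?_
  · split_ifs <;> norm_num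
  · have := le_ciSup (f := fun i => if i ∈ mismatch q c then (1 : ℝ) else
      if i ∈ q.1 then 0 else 1 / 2) (Set.finite_range _).bddAbove i
    simpa [hi] using this

theorem objective_wildcardPoint_of_empty {q : Finset (Fin n) × (Fin n → Bool)}
    {c : Fin n → Bool} (h : mismatch q c = ∅) :
    objective c (wildcardPoint q) = ⨆ i, if i ∈ q.1 then (0 : ℝ) else 1 / 2 := by
  rw [objective_of_mem_cube c (wildcardPoint_mem_cube q)]
  simp [abs_wildcardPoint_sub_corner, h]

theorem iSup_half_ne_one (S : Finset (Fin n)) :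
    (⨆ i, if i ∈ S then (0 : ℝ) else 1 / 2) ≠ 1 := by
  have : (⨆ i, if i ∈ S then (0 : ℝ) else 1 / 2) ≤ 1 / 2 :=
    Real.iSup_le (fun i => by split_ifs <;> norm_num) (by norm_num)
  intro h
  rw [h] at this
  norm_num at this

/-- The answer carries one bit about `c`: any mismatch gives 1, and otherwise the value is at most
`1/2` and depends only on the set. -/
theorem objective_wildcardPoint_ne_iff (q : Finset (Fin n) × (Fin n → Bool))
    (c c' : Fin n → Bool) : objective c (wildcardPoint q) ≠ objective c' (wildcardPoint q) ↔
      ¬ (mismatch q c = ∅ ↔ mismatch q c' = ∅) := by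
  by_cases h : mismatch q c = ∅ <;> by_cases h' : mismatch q c' = ∅
  · simp [h, h', objective_wildcardPoint_of_empty]
  · rw [objective_wildcardPoint_of_empty h,
      objective_wildcardPoint_of_nonempty (Finset.nonempty_iff_ne_empty.2 h')]
    simp only [h, h', iff_false, not_true, not_false_iff, iff_true]
    exact iSup_half_ne_one q.1
  · rw [objective_wildcardPoint_of_empty h',
      objective_wildcardPoint_of_nonempty (Finset.nonempty_iff_ne_empty.2 h)]
    simp only [h, h', not_false_iff, iff_true]
    exact (iSup_half_ne_one q.1).symm
  · simp [h, h', objective_wildcardPoint_of_nonempty, Finset.nonempty_iff_ne_empty]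

/-- The bits of `c` in `S`, extended by `false`. -/
def mask (S : Finset (Fin n)) (c : Fin n → Bool) : Fin n → Bool :=
  fun i => decide (i ∈ S) && c i

/-- All bits of `y` outside `S` are `false`. -/
def SupportedOn (S : Finset (Fin n)) (y : Fin n → Bool) : Prop := ∀ i, i ∉ S → y i = false

theorem mask_eq_iff (S : Finset (Fin n)) (c y : Fin n → Bool) :
    SupportedOn S y ∧ mismatch (S, y) c = ∅ ↔ y = mask S c := by
  simp only [funext_iff, mask, mismatch, SupportedOn, Finset.filter_eq_empty_iff, ne_eq, not_not]
  constructor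
  · rintro ⟨h1, h2⟩ i
    by_cases hi : i ∈ S
    · simp [hi, h2 hi]
    · simp [hi, h1 i hi]
  · intro h
    exact ⟨fun i hi => by rw [h i]; simp [hi], fun i hi => by rw [h i]; simp [hi]⟩

theorem mismatch_mask (S : Finset (Fin n)) (c c' : Fin n → Bool) :
    mismatch (S, mask S c) c' = S ∩ ({i | c i ≠ c' i} : Finset (Fin n)) := by
  ext i
  rw [mismatch, Finset.mem_filter, Finset.mem_inter, Finset.mem_filter]
  by_cases hi : i ∈ S <;> simp [mask, hi]

theorem exists_eq_mask_flip {S : Finset (Fin n)} {c y : Fin n → Bool} (hy : SupportedOn S y)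
    (h : (mismatch (S, y) c).card = 1) : ∃ i ∈ S, y = mask S (flip c i) := by
  obtain ⟨i, hi⟩ := Finset.card_eq_one.1 h
  have hmem : ∀ k, k ∈ mismatch (S, y) c ↔ k = i := fun k => by rw [hi, Finset.mem_singleton]
  simp only [mismatch, Finset.mem_filter] at hmem
  have hiS := (hmem i).2 rfl
  refine ⟨i, hiS.1, (mask_eq_iff S _ y).1 ⟨hy, ?_⟩⟩
  rw [mismatch, Finset.filter_eq_empty_iff]
  intro k hk hne
  by_cases hki : k = i
  · subst hki
    rw [flip_same] at hne
    have := hiS.2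
    dsimp only at hne
    revert this hne
    generalize y k = a
    generalize c k = b
    cases a <;> cases b <;> simp
  · rw [flip_of_ne c hki] at hne
    exact hki ((hmem k).1 ⟨hk, hne⟩)

open Classical in
/-- A feasible solution of the dual adversary problem. -/
noncomputable def dualVector (c : Fin n → Bool) (q : Finset (Fin n) × (Fin n → Bool)) : ℝ :=
  if SupportedOn q.1 q.2 then
    if mismatch q c = ∅ then Real.sqrt (queryWeight q.1 * Real.sqrt q.1.card / 2)
    else if (mismatch q c).card = 1 then Real.sqrt (queryWeight q.1 / Real.sqrt q.1.card / 2)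
    else 0
  else 0

/-- The factors `√|S|` and `1/√|S|` cancel in the pairing but balance the norm, where each `S` has
one full match and `|S|` near misses. For empty `S` the weight is `1/0 = 0`. -/
theorem sqrt_mul_sqrt_queryWeight (S : Finset (Fin n)) :
    Real.sqrt (queryWeight S * Real.sqrt S.card / 2) *
      Real.sqrt (queryWeight S / Real.sqrt S.card / 2) = queryWeight S / 2 := by
  have hw := queryWeight_nonneg S
  rw [← Real.sqrt_mul (by positivity)]
  rcases Nat.eq_zero_or_pos S.card with h | h
  · simp [queryWeight, h]
  · have hs : 0 < Real.sqrt S.card := Real.sqrt_pos.2 (by exact_mod_cast h)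
    rw [show queryWeight S * Real.sqrt S.card / 2 * (queryWeight S / Real.sqrt S.card / 2) =
      (queryWeight S / 2) ^ 2 by field_simp]
    exact Real.sqrt_sq (by positivity)

/-- If exactly one of `c`, `c'` matches, `y` is the mask of that one, and the other entry vanishes
unless it has a single mismatch. -/
theorem dualVector_mul_dualVector (c c' : Fin n → Bool) (S : Finset (Fin n))
    (y : Fin n → Bool) :
    (if ¬ (mismatch (S, y) c = ∅ ↔ mismatch (S, y) c' = ∅) then
        dualVector c (S, y) * dualVector c' (S, y) else 0) =
      (if y = mask S c then if (mismatch (S, y) c').card = 1 then queryWeight S / 2 else 0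
        else 0) +
      (if y = mask S c' then if (mismatch (S, y) c).card = 1 then queryWeight S / 2 else 0
        else 0) := by
  have hw := sqrt_mul_sqrt_queryWeight S
  have hw' := hw
  rw [mul_comm] at hw'
  have hm : ∀ c, y = mask S c ↔ SupportedOn S y ∧ mismatch (S, y) c = ∅ := fun c =>
    (mask_eq_iff S c y).symm
  by_cases hy : SupportedOn S y
  · by_cases h : mismatch (S, y) c = ∅ <;> by_cases h' : mismatch (S, y) c' = ∅
    · rw [if_neg (by simp [h, h']), if_pos ((hm c).2 ⟨hy, h⟩), if_pos ((hm c').2 ⟨hy, h'⟩), h, h']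
      simp
    · rw [if_pos (by simp [h, h']), if_pos ((hm c).2 ⟨hy, h⟩),
        if_neg (fun e => h' ((hm c').1 e).2), add_zero]
      by_cases h1 : (mismatch (S, y) c').card = 1 <;>
        simp only [dualVector, hy, h, h', h1, if_true, if_false, hw, mul_zero]
    · rw [if_pos (by simp [h, h']), if_neg (fun e => h ((hm c).1 e).2),
        if_pos ((hm c').2 ⟨hy, h'⟩), zero_add]
      by_cases h1 : (mismatch (S, y) c).card = 1 <;>
        simp only [dualVector, hy, h, h', h1, if_true, if_false, hw', zero_mul]
    · rw [if_neg (by simp [h, h']), if_neg (fun e => h ((hm c).1 e).2),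
        if_neg (fun e => h' ((hm c').1 e).2), add_zero]
  · rw [if_neg (fun e => hy ((hm c).1 e).1), if_neg (fun e => hy ((hm c').1 e).1)]
    simp [dualVector, hy]

/-- Summing out `y` leaves half the weight of each `S` with `|S ∩ Δ| = 1` from either endpoint, `Δ`
being the set where `c` and `c'` differ. -/
theorem sum_dualVector_mul_dualVector {c c' : Fin n → Bool} (h : c ≠ c') :
    ∑ q, (if ¬ (mismatch q c = ∅ ↔ mismatch q c' = ∅) then
      dualVector c q * dualVector c' q else 0) = 1 := by
  have hΔ : ({i | c i ≠ c' i} : Finset (Fin n)).Nonempty := by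
    obtain ⟨i, hi⟩ := Function.ne_iff.1 h
    exact ⟨i, by simpa using hi⟩
  have hsymm : ({i | c' i ≠ c i} : Finset (Fin n)) = ({i | c i ≠ c' i} : Finset (Fin n)) := by
    ext i; simp [eq_comm]
  rw [Fintype.sum_prod_type]
  simp only [dualVector_mul_dualVector, Finset.sum_add_distrib, Finset.sum_ite_eq',
    Finset.mem_univ, if_true, mismatch_mask, hsymm]
  have h1 := sum_queryWeight_card_inter_eq_one hΔ
  rw [← Finset.sum_add_distrib, ← h1]
  refine Finset.sum_congr rfl fun S _ => ?_
  split_ifs <;> ring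

theorem sum_dualVector_sq_le (c : Fin n → Bool) :
    ∑ q, dualVector c q ^ 2 ≤ 2 * Real.sqrt n := by
  refine le_trans ?_ (sum_queryWeight_mul_sqrt_le n)
  rw [Fintype.sum_prod_type]
  refine Finset.sum_le_sum fun S _ => ?_
  have hw := queryWeight_nonneg S
  have hpt : ∀ y, dualVector c (S, y) ^ 2 ≤
      (if y = mask S c then queryWeight S * Real.sqrt S.card / 2 else 0) +
      ∑ i ∈ S, (if y = mask S (flip c i) then queryWeight S / Real.sqrt S.card / 2 else 0) := by
    intro y
    have hsum : 0 ≤ ∑ i ∈ S,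
        (if y = mask S (flip c i) then queryWeight S / Real.sqrt S.card / 2 else 0) :=
      Finset.sum_nonneg fun i _ => by split_ifs <;> positivity
    have hfst : 0 ≤ (if y = mask S c then queryWeight S * Real.sqrt S.card / 2 else 0) := by
      split_ifs <;> positivity
    by_cases h1 : SupportedOn S y
    · by_cases h2 : mismatch (S, y) c = ∅
      · have h3 := (mask_eq_iff S c y).1 ⟨h1, h2⟩
        simp only [dualVector, h1, h2, if_true]
        rw [if_pos h3, Real.sq_sqrt (by positivity)]
        linarith
      · by_cases h4 : (mismatch (S, y) c).card = 1
        · obtain ⟨i, hi, hyi⟩ := exists_eq_mask_flip h1 h4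
          have := Finset.single_le_sum (f := fun i => if y = mask S (flip c i) then
            queryWeight S / Real.sqrt S.card / 2 else 0)
            (fun i _ => by split_ifs <;> positivity) hi
          rw [if_pos hyi] at this
          simp only [dualVector, h1, h2, h4, if_true, if_false]
          rw [Real.sq_sqrt (by positivity)]
          linarith
        · simp only [dualVector, h1, h2, h4, if_true, if_false]
          linarith
    · simp only [dualVector, h1, if_false]
      linarith
  refine (Finset.sum_le_sum fun y _ => hpt y).trans (le_of_eq ?_)
  rw [Finset.sum_add_distrib, Finset.sum_comm]
  simp only [Finset.sum_ite_eq', Finset.mem_univ, if_true, Finset.sum_const, nsmul_eq_mul]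
  rcases Nat.eq_zero_or_pos S.card with h | h
  · simp [queryWeight, h]
  · have h0 : (0 : ℝ) < S.card := by exact_mod_cast h
    have hs : 0 < Real.sqrt S.card := Real.sqrt_pos.2 h0
    have key : ∀ w s : ℝ, 0 < s → s * s * (w / s / 2) = w * s / 2 := fun w s hs => by
      field_simp
    have : (S.card : ℝ) * (queryWeight S / Real.sqrt S.card / 2) =
        queryWeight S * Real.sqrt S.card / 2 :=
      (congrArg (· * _) (Real.mul_self_sqrt h0.le).symm).trans (key _ _ hs)
    rw [this]
    ring

/-- `O(√n)` queries at grid points suffice to find the minimizer. -/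
theorem exists_solvesExactly (hn : 0 < n) {D : Set (Fin n → ℝ)} (hD : grid n ⊆ D) :
    ∃ A : Solver D, SolvesExactly A ∧ (A.queries : ℝ) ≤ 801 * Real.sqrt n := by
  have hs : 1 ≤ Real.sqrt n := by
    rw [Real.one_le_sqrt]; exact_mod_cast hn
  have hpoint : ∀ q : Finset (Fin n) × (Fin n → Bool), wildcardPoint q ∈ D := fun q =>
    hD (wildcardPoint_mem_grid q)
  let x : Finset (Fin n) × (Fin n → Bool) → D := fun q => ⟨wildcardPoint q, hpoint q⟩
  have hx : ∀ c c' q, evalOn D c (x q) ≠ evalOn D c' (x q) ↔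
      ¬ (mismatch q c = ∅ ↔ mismatch q c' = ∅) := fun c c' q =>
    objective_wildcardPoint_ne_iff q c c'
  -- The all-`1/2` point is the idle query: its value is the same for every `c`.
  have hx₀ : ∀ c c', evalOn D c (x (∅, fun _ => false)) = evalOn D c' (x (∅, fun _ => false)) := by
    intro c c'
    by_contra h
    exact (hx c c' _).1 h (iff_of_true rfl rfl)
  have hv : ∀ c c' : Fin n → Bool, c ≠ c' → ∑ q, (if evalOn D c (x q) ≠ evalOn D c' (x q) then
      dualVector c q * dualVector c' q else 0) = 1 := by
    intro c c' h
    rw [← sum_dualVector_mul_dualVector h]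
    refine Finset.sum_congr rfl fun q _ => ?_
    by_cases hd : mismatch q c = ∅ ↔ mismatch q c' = ∅
    · rw [if_neg (fun e => (hx c c' q).1 e hd), if_neg (fun e => e hd)]
    · rw [if_pos ((hx c c' q).2 hd), if_pos hd]
  have hK : 0 < ⌈800 * Real.sqrt n⌉₊ := Nat.ceil_pos.2 (by positivity)
  have hMK : 400 * (2 * Real.sqrt n) ≤ (⌈800 * Real.sqrt n⌉₊ : ℝ) := by
    linarith [Nat.le_ceil (800 * Real.sqrt n)]
  obtain ⟨A, hA, hp⟩ := exists_algorithm_of_dual_adversary hx₀ hv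
    sum_dualVector_sq_le hK hMK corner
  refine ⟨A, hp, ?_⟩
  rw [hA]
  linarith [Nat.ceil_lt_add_one (show 0 ≤ 800 * Real.sqrt n by positivity)]

theorem SolvesExactly.solves {D : Set (Fin n → ℝ)} {A : Solver D} (h : SolvesExactly A) :
    Solves A := fun c =>
  (h c).trans (A.prob_mono _ (Set.singleton_subset_iff.2 (corner_mem_approxMinimizers c)))

end MaxNorm

/-! ### The two bounds combined -/

theorem mainTheorem10 :
    ∃ a > (0 : ℝ), ∃ C > (0 : ℝ), ∀ n : ℕ, 2 ≤ n →
      ∀ D : Set (Fin n → ℝ), MaxNorm.grid n ⊆ D →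
        (∃ A : MaxNorm.Solver D, MaxNorm.SolvesExactly A ∧
          (A.queries : ℝ) ≤ C * (Real.sqrt n * Real.log n)) ∧
        (∃ Q : ℕ, MaxNorm.IsQueryComplexity D Q ∧
          a * (Real.sqrt n / Real.log n) ≤ (Q : ℝ) ∧
          (Q : ℝ) ≤ C * (Real.sqrt n * Real.log n)) := by
  refine ⟨1 / 20, by norm_num, 1200, by norm_num, fun n hn D hD => ?_⟩
  have : Nonempty (Fin n) := ⟨⟨0, by omega⟩⟩
  have hs : 0 ≤ Real.sqrt n := Real.sqrt_nonneg _
  have hlog : 0.69 ≤ Real.log n := by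
    have h1 : Real.log 2 ≤ Real.log n := Real.log_le_log (by norm_num) (by exact_mod_cast hn)
    linarith [Real.log_two_gt_d9]
  -- `1200 · 0.69 = 828 ≥ 801`; likewise `a = 1/20` works below since `(1/20)/0.69 < 7/80`.
  have hC : 801 * Real.sqrt n ≤ 1200 * (Real.sqrt n * Real.log n) := by nlinarith
  obtain ⟨A, hA, hq⟩ := MaxNorm.exists_solvesExactly (by omega) hD
  refine ⟨⟨A, hA, hq.trans hC⟩, ?_⟩
  have hne : {T : ℕ | ∃ A : MaxNorm.Solver D, MaxNorm.Solves A ∧ A.queries = T}.Nonempty :=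
    ⟨_, A, hA.solves, rfl⟩
  have hleast := isLeast_csInf hne
  refine ⟨_, hleast, ?_, ?_⟩
  · obtain ⟨B, hB, hBq⟩ := hleast.1
    rw [← hBq]
    refine le_trans ?_ (MaxNorm.sqrt_le_queries_of_solves B hB)
    have : Real.sqrt n / Real.log n ≤ Real.sqrt n / 0.69 :=
      div_le_div_of_nonneg_left hs (by norm_num) hlog
    have h2 : Real.sqrt n / 0.69 = Real.sqrt n * (100 / 69) := by ring
    rw [h2] at this
    linarith
  · refine le_trans ?_ (hq.trans hC)
    exact_mod_cast hleast.2 ⟨A, hA.solves, rfl⟩
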